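/- Let $\mathbb K$ be an algebraically closed field of characteristic $0$ and let $h,k,n\ge 0$ be integers with $n\ge (h+1)(k+1)-1$. By a subvariety of $\mathbb P^n=\mathbb P^n_{\mathbb K}$ we mean a Zariski-closed irreducible subset. For points $P=[a_0:\dots:a_n]$ and $Q=[b_0:\dots:b_n]$ of $\mathbb P^n$ the Hadamard product $P\odot Q=[a_0b_0:\dots:a_nb_n]$ is defined if some $a_ib_i\ne 0$, and for subvarieties $X,Y\subset\mathbb P^n$ the Hadamard product is the Zariski closure $$X\odot Y=\overline{\{P\odot Q : P\in X,\ Q\in Y,\ P\odot Q\text{ is defined}\}}.$$ Let $\sigma:\mathbb P^h\times\mathbb P^k\to\mathbb P^n$ be the Segre embedding $$\sigma([y_0:\dots:y_h],[z_0:\dots:z_k])=[y_0z_0:y_0z_1:\dots:y_0z_k:y_1z_0:\dots:y_hz_k:0:\dots:0].$$ There is a non-empty Zariski-open subset $U$ of the product of the Grassmannians of $h$-dimensional and of $k$-dimensional linear subspaces of $\mathbb P^n$ such that the following holds for all $(L_h,L_k)\in U$ (that is, for generic $L_h$ and $L_k$) and all subvarieties $X\subset L_h$ and $Y\subset L_k$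 of $\mathbb P^n$. 1. $X\odot Y$ and the product variety $X\times Y$ are projectively equivalent as subvarieties of $\mathbb P^n$: for all linear parameterizations $\varphi:\mathbb P^h\to L_h$ and $\psi:\mathbb P^k\to L_k$ (linear isomorphisms), $\sigma(\varphi^{-1}(X)\times\psi^{-1}(Y))$ and $X\odot Y$ are subvarieties of $\mathbb P^n$, and some projective automorphism of $\mathbb P^n$ maps the first onto the second. 2. $P\odot Q$ is defined for all $P\in X$ and $Q\in Y$, and $$X\odot Y=\{P\odot Q : P\in X,\ Q\in Y\}.$$ -/

import Mathlib

open scoped LinearAlgebra.Projectivization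

/-- Coordinate vectors of length `n + 1`. -/
abbrev Vec (K : Type*) (n : ℕ) : Type _ := Fin (n + 1) → K

/-- Projective `n`-space over `K`. -/
abbrev PSpace (K : Type*) [Field K] (n : ℕ) : Type _ := ℙ K (Vec K n)

section Zariski

variable {K : Type*} [Field K] {n : ℕ}

/-- The common zeros in projective space of a set of polynomials. It is only used for homogeneous
polynomials, for which vanishing does not depend on the representative of the point. -/
def projZeros (S : Set (MvPolynomial (Fin (n + 1)) K)) : Set (PSpace K n) :=
  {P | ∀ F ∈ S, MvPolynomial.eval P.rep F = 0}

/-- Algebraic subsets of projective space. -/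
def IsProjAlgebraic (Z : Set (PSpace K n)) : Prop :=
  ∃ S : Set (MvPolynomial (Fin (n + 1)) K),
    (∀ F ∈ S, ∃ d : ℕ, F.IsHomogeneous d) ∧ Z = projZeros S

theorem IsProjAlgebraic.empty : IsProjAlgebraic (∅ : Set (PSpace K n)) := by
  refine ⟨{1}, ?_, ?_⟩
  · rintro F rfl
    exact ⟨0, MvPolynomial.isHomogeneous_one _ _⟩
  · ext P
    simp [projZeros]

theorem IsProjAlgebraic.sInter (A : Set (Set (PSpace K n))) (hA : ∀ Z ∈ A, IsProjAlgebraic Z) :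
    IsProjAlgebraic (⋂₀ A) := by
  refine ⟨{F | (∃ d : ℕ, F.IsHomogeneous d) ∧ ∃ Z ∈ A, ∀ P ∈ Z, MvPolynomial.eval P.rep F = 0},
    fun F hF => hF.1, ?_⟩
  ext P
  constructor
  · rintro hP F ⟨-, Z, hZ, hF⟩
    exact hF P (hP Z hZ)
  · intro hP Z hZ
    obtain ⟨S, hS, rfl⟩ := hA Z hZ
    intro F hF
    exact hP F ⟨hS F hF, _, hZ, fun Q hQ => hQ F hF⟩

theorem IsProjAlgebraic.union (Z W : Set (PSpace K n)) (hZ : IsProjAlgebraic Z)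
    (hW : IsProjAlgebraic W) : IsProjAlgebraic (Z ∪ W) := by
  obtain ⟨S, hS, rfl⟩ := hZ
  obtain ⟨T, hT, rfl⟩ := hW
  refine ⟨Set.image2 (· * ·) S T, ?_, ?_⟩
  · rintro _ ⟨F, hF, G, hG, rfl⟩
    obtain ⟨d, hd⟩ := hS F hF
    obtain ⟨e, he⟩ := hT G hG
    exact ⟨d + e, hd.mul he⟩
  · ext P
    constructor
    · rintro (hP | hP) _ ⟨F, hF, G, hG, rfl⟩
      · simp [hP F hF]
      · simp [hP G hG]
    · intro hP
      by_contra hcon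
      simp only [Set.mem_union, not_or, projZeros, Set.mem_ofPred_eq, not_forall] at hcon
      obtain ⟨⟨F, hF, hF0⟩, G, hG, hG0⟩ := hcon
      have h := hP _ ⟨F, hF, G, hG, rfl⟩
      simp only [map_mul, mul_eq_zero] at h
      tauto

/-- The Zariski topology on projective space: the closed sets are the algebraic sets. -/
instance zariskiTopology : TopologicalSpace (PSpace K n) :=
  TopologicalSpace.ofClosed {Z | IsProjAlgebraic Z} IsProjAlgebraic.empty
    (fun A hA => IsProjAlgebraic.sInter A hA)
    (fun Z hZ W hW => IsProjAlgebraic.union Z W hZ hW)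

/-- A subvariety of projective space: a Zariski-closed irreducible (so non-empty) subset. -/
def IsSubvariety (Z : Set (PSpace K n)) : Prop :=
  IsClosed Z ∧ IsIrreducible Z

/-- `Z` and `W` are projectively equivalent as subvarieties of projective space: both are
subvarieties, and some projective automorphism maps `Z` onto `W`. -/
def ProjectivelyEquivalent (Z W : Set (PSpace K n)) : Prop :=
  IsSubvariety Z ∧ IsSubvariety W ∧
    ∃ g : Vec K n ≃ₗ[K] Vec K n,
      Projectivization.map (g : Vec K n →ₗ[K] Vec K n) g.injective '' Z = W

end Zariski

section Hadamard

variable {K : Type*} [Field K] {n : ℕ}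

/-- The Hadamard product of `P` and `Q` is defined if the coordinatewise product of coordinate
vectors of `P` and `Q` is not the zero vector. -/
def HadamardDefined (P Q : PSpace K n) : Prop := P.rep * Q.rep ≠ 0

/-- The Hadamard product `[a₀ b₀ : … : aₙ bₙ]` of `[a₀ : … : aₙ]` and `[b₀ : … : bₙ]`. -/
noncomputable def hadamardPoint (P Q : PSpace K n) (h : HadamardDefined P Q) : PSpace K n :=
  Projectivization.mk K (P.rep * Q.rep) h

/-- The set of all (defined) products `P ⊙ Q` with `P ∈ X` and `Q ∈ Y`. -/
def hadamardPoints (X Y : Set (PSpace K n)) : Set (PSpace K n) :=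
  {R | ∃ P ∈ X, ∃ Q ∈ Y, ∃ h : HadamardDefined P Q, R = hadamardPoint P Q h}

/-- The Hadamard product `X ⊙ Y`: the Zariski closure of the set of all products `P ⊙ Q`. -/
def hadamardProduct (X Y : Set (PSpace K n)) : Set (PSpace K n) :=
  closure (hadamardPoints X Y)

end Hadamard

section Segre

variable {K : Type*} [Field K] {n h k : ℕ}

/-- The vector `(y₀z₀, y₀z₁, …, y₀zₖ, y₁z₀, …, yₕzₖ, 0, …, 0)` of length `n + 1`. -/
def segreVec (n : ℕ) (y : Vec K h) (z : Vec K k) : Vec K n := fun t =>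
  if ht : (t : ℕ) < (h + 1) * (k + 1) then
    y (finProdFinEquiv.symm ⟨t, ht⟩).1 * z (finProdFinEquiv.symm ⟨t, ht⟩).2
  else 0

theorem segreVec_ne_zero (hn : (h + 1) * (k + 1) ≤ n + 1) {y : Vec K h} {z : Vec K k}
    (hy : y ≠ 0) (hz : z ≠ 0) : segreVec n y z ≠ 0 := by
  obtain ⟨i, hi⟩ := Function.ne_iff.mp hy
  obtain ⟨j, hj⟩ := Function.ne_iff.mp hz
  intro h0
  have h1 := congrFun h0 ⟨finProdFinEquiv (i, j), (finProdFinEquiv (i, j)).2.trans_le hn⟩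
  simp only [segreVec, Fin.is_lt, dite_true, Fin.eta, Equiv.symm_apply_apply, Pi.zero_apply,
    mul_eq_zero] at h1
  exact h1.elim hi hj

/-- The Segre embedding of the product of projective `h`-space and projective `k`-space in
projective `n`-space, for `n ≥ (h + 1)(k + 1) - 1`. -/
noncomputable def segre (hn : (h + 1) * (k + 1) ≤ n + 1) (p : PSpace K h × PSpace K k) :
    PSpace K n :=
  Projectivization.mk K (segreVec n p.1.rep p.2.rep)
    (segreVec_ne_zero hn p.1.rep_nonzero p.2.rep_nonzero)

end Segre

section Generic

/-- The Grassmannian of `d`-dimensional linear subspaces of projective `n`-space, as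
`(d + 1)`-dimensional linear subspaces of the space of coordinate vectors. -/
abbrev Grass (K : Type*) [Field K] (n d : ℕ) : Type _ :=
  {L : Submodule K (Vec K n) // Module.finrank K L = d + 1}

variable {K : Type*} [Field K] {n h k : ℕ}

/-- The set of points of a linear subspace of projective space. -/
def Grass.points {d : ℕ} (L : Grass K n d) : Set (PSpace K n) := {P | P.submodule ≤ L.1}

/-- The linear subspace spanned by `d + 1` linearly independent vectors. -/
def Grass.ofFrame {d : ℕ} (a : Fin (d + 1) → Vec K n) (ha : LinearIndependent K a) :
    Grass K n d :=
  ⟨Submodule.span K (Set.range a), by simpa using finrank_span_eq_card ha⟩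

/-- Zariski-open subsets of the product of two Grassmannians. The Grassmannian has the quotient
topology from the variety of frames, so `U` is open if and only if the set of pairs of frames
which span a pair in `U` is open in the variety of pairs of frames, that is, it is the locus
where not all the polynomials of some set `S` in the entries of the two frames vanish. -/
def IsOpenInGrassProd (U : Set (Grass K n h × Grass K n k)) : Prop :=
  ∃ S : Set (MvPolynomial ((Fin (h + 1) × Fin (n + 1)) ⊕ (Fin (k + 1) × Fin (n + 1))) K),
    ∀ (a : Fin (h + 1) → Vec K n) (b : Fin (k + 1) → Vec K n)
      (ha : LinearIndependent K a) (hb : LinearIndependent K b),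
      (Grass.ofFrame a ha, Grass.ofFrame b hb) ∈ U ↔
        ∃ F ∈ S, MvPolynomial.eval (Sum.elim (fun s => a s.1 s.2) (fun s => b s.1 s.2)) F ≠ 0

/-- A property holds for generic pairs of linear subspaces of dimensions `h` and `k` of projective
`n`-space if it holds for all pairs in some non-empty Zariski-open set. -/
def ForGenericPair (p : Grass K n h → Grass K n k → Prop) : Prop :=
  ∃ U : Set (Grass K n h × Grass K n k), IsOpenInGrassProd U ∧ U.Nonempty ∧
    ∀ L ∈ U, p L.1 L.2

end Generic

/-!
The Hadamard product of points is induced by the multiplication of the algebra `K ^ (n + 1)`. Two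
generic linear subspaces of this algebra are linearly disjoint: the products of the vectors of two
frames are linearly independent, which is an open condition because it says that some maximal minor
of the matrix of these products does not vanish. As long as `(h + 1) (k + 1) ≤ n + 1`, it holds
for a suitable pair of frames of `0`-`1` vectors.

If the ranges of `f` and `g` are linearly disjoint, then a linear automorphism sends the Segre
vectors of `(eᵢ, eⱼ)`, which are standard basis vectors, to the linearly independent products
`f eᵢ * g eⱼ`, and by bilinearity the Segre vector of `(y, z)` to `f y * g z`. So the
products `P ⊙ Q` are all defined, and they form the image of a Segre product under a projective
automorphism. This image is already closed.
-/

section AffineCone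

variable {K V : Type*} [DivisionRing K] [AddCommGroup V] [Module K V]

/-- The affine cone over a set of points of a projective space: the vectors which represent a point
of the set, together with the zero vector. -/
def affineCone (Z : Set (ℙ K V)) : Set V :=
  {v | ∀ hv : v ≠ 0, Projectivization.mk K v hv ∈ Z}

theorem mem_affineCone_iff {Z : Set (ℙ K V)} {v : V} (hv : v ≠ 0) :
    v ∈ affineCone Z ↔ Projectivization.mk K v hv ∈ Z :=
  ⟨fun h => h hv, fun h _ => h⟩

theorem rep_mem_affineCone_iff {Z : Set (ℙ K V)} {P : ℙ K V} : P.rep ∈ affineCone Z ↔ P ∈ Z := by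
  rw [mem_affineCone_iff P.rep_nonzero, P.mk_rep]

theorem smul_mem_affineCone_iff {Z : Set (ℙ K V)} {c : K} (hc : c ≠ 0) {v : V} :
    c • v ∈ affineCone Z ↔ v ∈ affineCone Z := by
  rcases eq_or_ne v 0 with rfl | hv
  · rw [smul_zero]
  have hmk : Projectivization.mk K (c • v) (smul_ne_zero hc hv) = Projectivization.mk K v hv :=
    (Projectivization.mk_eq_mk_iff' K _ _ _ _).mpr ⟨c, rfl⟩
  rw [mem_affineCone_iff (smul_ne_zero hc hv), mem_affineCone_iff hv, hmk]

theorem forall_smul_mem_affineCone_iff {Z : Set (ℙ K V)} {ι : Type*} {a : ι → K} (ha : a ≠ 0)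
    {v : V} : (∀ i, a i • v ∈ affineCone Z) ↔ v ∈ affineCone Z := by
  refine ⟨fun hv => ?_, fun hv i => ?_⟩
  · obtain ⟨i, hi⟩ := Function.ne_iff.mp ha
    exact (smul_mem_affineCone_iff hi).mp (hv i)
  · rcases eq_or_ne (a i) 0 with hi | hi
    · simp [affineCone, hi]
    · exact (smul_mem_affineCone_iff hi).mpr hv

theorem mem_affineCone_empty_iff {v : V} : v ∈ affineCone (∅ : Set (ℙ K V)) ↔ v = 0 := by
  simp [affineCone]

end AffineCone

section ProjectiveMap

variable {K V W : Type*} [DivisionRing K] [AddCommGroup V] [Module K V] [AddCommGroup W]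
  [Module K W]

theorem exists_rep_map_eq_smul (f : V →ₗ[K] W) (hf : Function.Injective f) (P : ℙ K V) :
    ∃ c : K, c ≠ 0 ∧ (Projectivization.map f hf P).rep = c • f P.rep := by
  have hP : Projectivization.map f hf P = Projectivization.mk K (f P.rep)
      ((map_ne_zero_iff f hf).mpr P.rep_nonzero) := by
    conv_lhs => rw [← P.mk_rep, Projectivization.map_mk]
  obtain ⟨c, hc⟩ := Projectivization.exists_smul_eq_mk_rep K (f P.rep)
    ((map_ne_zero_iff f hf).mpr P.rep_nonzero)
  exact ⟨c, c.ne_zero, by rw [hP, ← hc, Units.smul_def]⟩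

theorem mem_range_map_iff (f : V →ₗ[K] W) (hf : Function.Injective f) {P : ℙ K W} :
    P ∈ Set.range (Projectivization.map f hf) ↔ P.rep ∈ LinearMap.range f := by
  constructor
  · rintro ⟨Q, rfl⟩
    obtain ⟨c, -, hc⟩ := exists_rep_map_eq_smul f hf Q
    exact ⟨c • Q.rep, by rw [map_smul, hc]⟩
  · rintro ⟨v, hv⟩
    have hv0 : v ≠ 0 := by
      rintro rfl
      exact P.rep_nonzero (by rw [← hv, map_zero])
    exact ⟨Projectivization.mk K v hv0, by
      simp only [Projectivization.map_mk, hv, Projectivization.mk_rep]⟩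

end ProjectiveMap

section HomogeneousPolynomials

variable {R σ τ : Type*} [CommSemiring R]

theorem eval_smul_of_isHomogeneous {F : MvPolynomial σ R} {d : ℕ} (hF : F.IsHomogeneous d) (c : R)
    (v : σ → R) : MvPolynomial.eval (c • v) F = c ^ d * MvPolynomial.eval v F := by
  simp only [MvPolynomial.eval_eq, Finset.mul_sum, Pi.smul_apply, smul_eq_mul, mul_pow,
    Finset.prod_mul_distrib, Finset.prod_pow_eq_pow_sum]
  refine Finset.sum_congr rfl fun s hs => ?_
  rw [← hF.degree_eq_sum_deg_support hs, mul_left_comm]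

variable [Fintype σ]

theorem eval_bind₁_toMvPolynomial (M : Matrix τ σ R) (F : MvPolynomial τ R) (v : σ → R) :
    MvPolynomial.eval v (MvPolynomial.bind₁ M.toMvPolynomial F) =
      MvPolynomial.eval (M.mulVec v) F := by
  simp only [← MvPolynomial.aeval_eq_eval, MvPolynomial.aeval_bind₁]
  simp only [MvPolynomial.aeval_eq_eval, Matrix.toMvPolynomial_eval_eq_apply]

theorem isHomogeneous_bind₁_toMvPolynomial (M : Matrix τ σ R) {F : MvPolynomial τ R} {d : ℕ}
    (hF : F.IsHomogeneous d) : (MvPolynomial.bind₁ M.toMvPolynomial F).IsHomogeneous d :=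
  one_mul d ▸ hF.aeval _ M.toMvPolynomial_isHomogeneous

end HomogeneousPolynomials

section ZariskiTopology

variable {K : Type*} [Field K] {m n : ℕ}

theorem isClosed_iff_isProjAlgebraic {Z : Set (PSpace K n)} : IsClosed Z ↔ IsProjAlgebraic Z := by
  rw [← isOpen_compl_iff]
  change Zᶜᶜ ∈ {Z : Set (PSpace K n) | IsProjAlgebraic Z} ↔ _
  rw [compl_compl, Set.mem_ofPred_eq]

theorem isClosed_setOf_eval_rep_eq_zero {F : MvPolynomial (Fin (n + 1)) K} {d : ℕ}
    (hF : F.IsHomogeneous d) : IsClosed {P : PSpace K n | MvPolynomial.eval P.rep F = 0} := by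
  refine isClosed_iff_isProjAlgebraic.mpr ⟨{F}, ?_, ?_⟩
  · rintro _ rfl
    exact ⟨d, hF⟩
  · simp [projZeros]

theorem mem_affineCone_projZeros_iff {S : Set (MvPolynomial (Fin (n + 1)) K)}
    (hS : ∀ F ∈ S, ∃ d : ℕ, F.IsHomogeneous d) {v : Vec K n} :
    v ∈ affineCone (projZeros S) ↔ v = 0 ∨ ∀ F ∈ S, MvPolynomial.eval v F = 0 := by
  rcases eq_or_ne v 0 with rfl | hv
  · simp [affineCone]
  obtain ⟨c, hc⟩ := Projectivization.exists_smul_eq_mk_rep K v hv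
  rw [mem_affineCone_iff hv, or_iff_right hv]
  refine forall₂_congr fun F hF => ?_
  obtain ⟨d, hd⟩ := hS F hF
  rw [← hc, Units.smul_def, eval_smul_of_isHomogeneous hd,
    mul_eq_zero_iff_left (pow_ne_zero d c.ne_zero)]

/-- Zero is in every affine cone, so this set is cut out by the products of the pulled back
equations with the coordinates of `f P.rep`. -/
theorem isClosed_setOf_apply_rep_mem_affineCone (f : Vec K m →ₗ[K] Vec K n) {Z : Set (PSpace K n)}
    (hZ : IsClosed Z) : IsClosed {P : PSpace K m | f P.rep ∈ affineCone Z} := by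
  obtain ⟨S, hS, rfl⟩ := isClosed_iff_isProjAlgebraic.mp hZ
  let M := LinearMap.toMatrix' f
  have heq : {P : PSpace K m | f P.rep ∈ affineCone (projZeros S)} = ⋂ F ∈ S, ⋂ i,
      {P | MvPolynomial.eval P.rep
        (M.toMvPolynomial i * MvPolynomial.bind₁ M.toMvPolynomial F) = 0} := by
    ext P
    simp only [M, Set.mem_ofPred_eq, Set.mem_iInter, mem_affineCone_projZeros_iff hS, map_mul,
      eval_bind₁_toMvPolynomial, Matrix.toMvPolynomial_eval_eq_apply, LinearMap.toMatrix'_mulVec,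
      mul_eq_zero, funext_iff, Pi.zero_apply, ← forall_or_right, ← forall_or_left]
  rw [heq]
  refine isClosed_biInter fun F hF => isClosed_iInter fun i => ?_
  obtain ⟨d, hd⟩ := hS F hF
  exact isClosed_setOf_eval_rep_eq_zero
    ((M.toMvPolynomial_isHomogeneous i).mul (isHomogeneous_bind₁_toMvPolynomial M hd))

theorem preimage_map_eq_setOf_apply_rep_mem_affineCone (f : Vec K m →ₗ[K] Vec K n)
    (hf : Function.Injective f) (Z : Set (PSpace K n)) :
    Projectivization.map f hf ⁻¹' Z = {P | f P.rep ∈ affineCone Z} := by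
  ext P
  obtain ⟨c, hc, hcP⟩ := exists_rep_map_eq_smul f hf P
  rw [Set.mem_preimage, ← rep_mem_affineCone_iff, hcP, smul_mem_affineCone_iff hc,
    Set.mem_ofPred_eq]

theorem continuous_map (f : Vec K m →ₗ[K] Vec K n) (hf : Function.Injective f) :
    Continuous (Projectivization.map f hf) := by
  refine continuous_iff_isClosed.mpr fun Z hZ => ?_
  rw [preimage_map_eq_setOf_apply_rep_mem_affineCone]
  exact isClosed_setOf_apply_rep_mem_affineCone f hZ

theorem isClosed_range_map (f : Vec K m →ₗ[K] Vec K n) (hf : Function.Injective f) :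
    IsClosed (Set.range (Projectivization.map f hf)) := by
  obtain ⟨r, hr⟩ := f.exists_leftInverse_of_injective (LinearMap.ker_eq_bot.mpr hf)
  have hrange : Set.range (Projectivization.map f hf) =
      {P | (LinearMap.id - f ∘ₗ r : Vec K n →ₗ[K] Vec K n) P.rep ∈
        affineCone (∅ : Set (PSpace K n))} := by
    ext P
    simp only [mem_range_map_iff, Set.mem_ofPred_eq, mem_affineCone_empty_iff, LinearMap.sub_apply,
      LinearMap.id_apply, LinearMap.comp_apply, sub_eq_zero]
    constructor
    · rintro ⟨v, hv⟩
      rw [← hv, ← LinearMap.comp_apply r f, hr, LinearMap.id_apply]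
    · exact fun hP => ⟨r P.rep, hP.symm⟩
  rw [hrange]
  exact isClosed_setOf_apply_rep_mem_affineCone _ isClosed_empty

theorem isClosedEmbedding_map (f : Vec K m →ₗ[K] Vec K n) (hf : Function.Injective f) :
    Topology.IsClosedEmbedding (Projectivization.map f hf) := by
  refine .of_continuous_injective_isClosedMap (continuous_map f hf)
    (Projectivization.map_injective f hf) fun Z hZ => ?_
  obtain ⟨r, hr⟩ := f.exists_leftInverse_of_injective (LinearMap.ker_eq_bot.mpr hf)
  have hpreimage : Projectivization.map f hf ⁻¹' {P | r P.rep ∈ affineCone Z} = Z := by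
    ext P
    obtain ⟨c, hc, hcP⟩ := exists_rep_map_eq_smul f hf P
    rw [Set.mem_preimage, Set.mem_ofPred_eq, hcP, map_smul, smul_mem_affineCone_iff hc,
      ← LinearMap.comp_apply, hr, LinearMap.id_apply, rep_mem_affineCone_iff]
  rw [← hpreimage, Set.image_preimage_eq_inter_range]
  exact (isClosed_setOf_apply_rep_mem_affineCone r hZ).inter (isClosed_range_map f hf)

end ZariskiTopology

section Irreducible

theorem isIrreducible_image_iff {A B : Type*} [TopologicalSpace A] [TopologicalSpace B] {f : A → B}
    (hf : Topology.IsInducing f) {s : Set A} : IsIrreducible (f '' s) ↔ IsIrreducible s := by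
  refine ⟨fun hs => ⟨hs.nonempty.of_image, ?_⟩, fun hs => hs.image f hf.continuous.continuousOn⟩
  rintro u v hu hv ⟨x, hx, hxu⟩ ⟨y, hy, hyv⟩
  obtain ⟨u, hu', rfl⟩ := hf.isOpen_iff.mp hu
  obtain ⟨v, hv', rfl⟩ := hf.isOpen_iff.mp hv
  obtain ⟨_, ⟨w, hw, rfl⟩, hwuv⟩ := hs.isPreirreducible u v hu' hv'
    ⟨f x, Set.mem_image_of_mem f hx, hxu⟩ ⟨f y, Set.mem_image_of_mem f hy, hyv⟩
  exact ⟨w, hw, hwuv⟩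

theorem isIrreducible_image_prod {A B C : Type*} [TopologicalSpace A] [TopologicalSpace B]
    [TopologicalSpace C] {s : Set A} {t : Set B} (hs : IsIrreducible s) (ht : IsIrreducible t)
    {f : A × B → C} (hfs : ∀ b, Continuous fun a => f (a, b))
    (hft : ∀ a, Continuous fun b => f (a, b)) : IsIrreducible (f '' s ×ˢ t) := by
  refine ⟨(hs.nonempty.prod ht.nonempty).image f, ?_⟩
  rintro u v hu hv ⟨_, ⟨⟨a, b⟩, ⟨ha, hb⟩, rfl⟩, hab⟩ ⟨_, ⟨⟨a', b'⟩, ⟨ha', hb'⟩, rfl⟩, hab'⟩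
  obtain ⟨x, hx, hxu, hxv⟩ := hs.isPreirreducible _ _ (hu.preimage (hfs b)) (hv.preimage (hfs b'))
    ⟨a, ha, hab⟩ ⟨a', ha', hab'⟩
  obtain ⟨y, hy, hyu, hyv⟩ := ht.isPreirreducible _ _ (hu.preimage (hft x)) (hv.preimage (hft x))
    ⟨b, hb, hxu⟩ ⟨b', hb', hxv⟩
  exact ⟨f (x, y), ⟨(x, y), ⟨hx, hy⟩, rfl⟩, hyu, hyv⟩

variable {K : Type*} [Field K] {m n : ℕ}

theorem IsSubvariety.preimage_map {X : Set (PSpace K n)} (hX : IsSubvariety X)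
    (f : Vec K m →ₗ[K] Vec K n) (hf : Function.Injective f)
    (hXf : X ⊆ Set.range (Projectivization.map f hf)) :
    IsSubvariety (Projectivization.map f hf ⁻¹' X) :=
  ⟨hX.1.preimage (continuous_map f hf), (isIrreducible_image_iff
    (isClosedEmbedding_map f hf).isInducing).mp ((Set.image_preimage_eq_of_subset hXf).symm ▸ hX.2)⟩

theorem IsSubvariety.image_map {X : Set (PSpace K m)} (hX : IsSubvariety X)
    (f : Vec K m →ₗ[K] Vec K n) (hf : Function.Injective f) :
    IsSubvariety (Projectivization.map f hf '' X) :=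
  ⟨(isClosedEmbedding_map f hf).isClosedMap X hX.1,
    hX.2.image _ (continuous_map f hf).continuousOn⟩

end Irreducible

section Segre

variable {K : Type*} [Field K] {n h k : ℕ}

/-- The position in `segreVec n y z` of the product `y i * z j`, as a function of `(i, j)`. -/
def segreIndex (hn : (h + 1) * (k + 1) ≤ n + 1) : Fin (h + 1) × Fin (k + 1) ↪ Fin (n + 1) :=
  finProdFinEquiv.toEmbedding.trans (Fin.castLEEmb hn)

theorem segreVec_segreIndex (hn : (h + 1) * (k + 1) ≤ n + 1) (y : Vec K h) (z : Vec K k)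
    (p : Fin (h + 1) × Fin (k + 1)) : segreVec n y z (segreIndex hn p) = y p.1 * z p.2 := by
  have hp : ((segreIndex hn p : Fin (n + 1)) : ℕ) < (h + 1) * (k + 1) := (finProdFinEquiv p).2
  have hp' : (⟨segreIndex hn p, hp⟩ : Fin ((h + 1) * (k + 1))) = finProdFinEquiv p := rfl
  rw [segreVec, dif_pos hp, hp', Equiv.symm_apply_apply]

theorem segreVec_of_notMem_range (hn : (h + 1) * (k + 1) ≤ n + 1) (y : Vec K h) (z : Vec K k)
    {t : Fin (n + 1)} (ht : t ∉ Set.range (segreIndex hn)) : segreVec n y z t = 0 :=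
  dif_neg fun hlt => ht ⟨finProdFinEquiv.symm ⟨t, hlt⟩,
    congrArg (Fin.castLE hn) (finProdFinEquiv.apply_symm_apply ⟨t, hlt⟩)⟩

theorem segreVec_mul_segreVec (y y' : Vec K h) (z z' : Vec K k) :
    segreVec n y z * segreVec n y' z' = segreVec n (y * y') (z * z') := by
  ext t
  simp only [segreVec, Pi.mul_apply]
  split_ifs <;> ring

theorem segreVec_single (hn : (h + 1) * (k + 1) ≤ n + 1) (p : Fin (h + 1) × Fin (k + 1)) :
    segreVec n (Pi.single p.1 1 : Vec K h) (Pi.single p.2 1 : Vec K k) =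
      Pi.single (segreIndex hn p) 1 := by
  ext t
  by_cases ht : t ∈ Set.range (segreIndex hn)
  · obtain ⟨q, rfl⟩ := ht
    simp only [segreVec_segreIndex, Pi.single_apply, (segreIndex hn).apply_eq_iff_eq, Prod.ext_iff,
      ite_and, mul_ite, mul_one, mul_zero]
    split_ifs <;> rfl
  · rw [segreVec_of_notMem_range hn _ _ ht, Pi.single_eq_of_ne]
    rintro rfl
    exact ht ⟨p, rfl⟩

/-- The bilinear map underlying the Segre embedding. -/
def segreLinear (K : Type*) [Field K] (n h k : ℕ) : Vec K h →ₗ[K] Vec K k →ₗ[K] Vec K n :=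
  LinearMap.mk₂ K (segreVec n)
    (fun y y' z => by ext t; simp only [segreVec, Pi.add_apply]; split_ifs <;> ring)
    (fun c y z => by
      ext t; simp only [segreVec, Pi.smul_apply, smul_eq_mul]; split_ifs <;> ring)
    (fun y z z' => by ext t; simp only [segreVec, Pi.add_apply]; split_ifs <;> ring)
    (fun c y z => by
      ext t; simp only [segreVec, Pi.smul_apply, smul_eq_mul]; split_ifs <;> ring)

theorem segreLinear_apply (y : Vec K h) (z : Vec K k) :
    segreLinear K n h k y z = segreVec n y z := rfl

theorem segreVec_smul_smul (a b : K) (y : Vec K h) (z : Vec K k) :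
    segreVec n (a • y) (b • z) = (a * b) • segreVec n y z := by
  simp only [← segreLinear_apply, map_smul, LinearMap.smul_apply, smul_smul, mul_comm]

theorem segre_mk (hn : (h + 1) * (k + 1) ≤ n + 1) (y : Vec K h) (z : Vec K k) (hy : y ≠ 0)
    (hz : z ≠ 0) :
    segre hn (Projectivization.mk K y hy, Projectivization.mk K z hz) =
      Projectivization.mk K (segreVec n y z) (segreVec_ne_zero hn hy hz) := by
  obtain ⟨a, ha⟩ := Projectivization.exists_smul_eq_mk_rep K y hy
  obtain ⟨b, hb⟩ := Projectivization.exists_smul_eq_mk_rep K z hz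
  refine (Projectivization.mk_eq_mk_iff' K _ _ _ _).mpr ⟨a * b, ?_⟩
  rw [← ha, ← hb, Units.smul_def, Units.smul_def, segreVec_smul_smul]

theorem continuous_segre_left (hn : (h + 1) * (k + 1) ≤ n + 1) (Q : PSpace K k) :
    Continuous fun P : PSpace K h => segre hn (P, Q) := by
  have hinj : Function.Injective ((segreLinear K n h k).flip Q.rep) :=
    (injective_iff_map_eq_zero _).mpr fun y hy =>
      by_contra fun hy0 => segreVec_ne_zero hn hy0 Q.rep_nonzero hy
  have hsegre : (fun P => segre hn (P, Q)) = Projectivization.map _ hinj := by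
    ext1 P
    conv_rhs => rw [← P.mk_rep, Projectivization.map_mk]
    rfl
  exact hsegre ▸ continuous_map _ hinj

theorem continuous_segre_right (hn : (h + 1) * (k + 1) ≤ n + 1) (P : PSpace K h) :
    Continuous fun Q : PSpace K k => segre hn (P, Q) := by
  have hinj : Function.Injective (segreLinear K n h k P.rep) :=
    (injective_iff_map_eq_zero _).mpr fun z hz =>
      by_contra fun hz0 => segreVec_ne_zero hn P.rep_nonzero hz0 hz
  have hsegre : (fun Q => segre hn (P, Q)) = Projectivization.map _ hinj := by
    ext1 Q
    conv_rhs => rw [← Q.mk_rep, Projectivization.map_mk]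
    rfl
  exact hsegre ▸ continuous_map _ hinj

/-- Regard `v` as the matrix with entries `v (segreIndex hn (i, j))`. If its `2 × 2` minors vanish,
it is the product of the column and the row through a non-zero entry, divided by that entry. -/
theorem exists_segreVec_eq_iff (hn : (h + 1) * (k + 1) ≤ n + 1) {v : Vec K n} :
    (∃ (y : Vec K h) (z : Vec K k), segreVec n y z = v) ↔
      (∀ t ∉ Set.range (segreIndex hn), v t = 0) ∧
        ∀ i i' j j', v (segreIndex hn (i, j)) * v (segreIndex hn (i', j')) =
          v (segreIndex hn (i, j')) * v (segreIndex hn (i', j)) := by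
  constructor
  · rintro ⟨y, z, rfl⟩
    refine ⟨fun t ht => segreVec_of_notMem_range hn y z ht, fun i i' j j' => ?_⟩
    simp only [segreVec_segreIndex]
    ring
  rintro ⟨hv0, hminor⟩
  rcases eq_or_ne v 0 with rfl | hv
  · exact ⟨0, 0, by rw [← segreLinear_apply, map_zero]⟩
  obtain ⟨t, ht⟩ := Function.ne_iff.mp hv
  obtain ⟨⟨i₀, j₀⟩, rfl⟩ := not_imp_comm.mp (hv0 t) ht
  refine ⟨fun i => v (segreIndex hn (i, j₀)),
    fun j => (v (segreIndex hn (i₀, j₀)))⁻¹ * v (segreIndex hn (i₀, j)), ?_⟩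
  ext t
  by_cases ht' : t ∈ Set.range (segreIndex hn)
  · obtain ⟨⟨i, j⟩, rfl⟩ := ht'
    rw [segreVec_segreIndex, mul_left_comm, hminor i i₀ j₀ j, mul_comm (v _), ← mul_assoc,
      inv_mul_cancel₀ ht, one_mul]
  · rw [segreVec_of_notMem_range hn _ _ ht', hv0 t ht']

theorem exists_rep_segre_eq_smul (hn : (h + 1) * (k + 1) ≤ n + 1) (P : PSpace K h)
    (Q : PSpace K k) : ∃ c : K, c ≠ 0 ∧ (segre hn (P, Q)).rep = c • segreVec n P.rep Q.rep := by
  obtain ⟨c, hc⟩ := Projectivization.exists_smul_eq_mk_rep K (segreVec n P.rep Q.rep)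
    (segreVec_ne_zero hn P.rep_nonzero Q.rep_nonzero)
  exact ⟨c, c.ne_zero, hc.symm⟩

theorem mem_range_segre_iff (hn : (h + 1) * (k + 1) ≤ n + 1) {R : PSpace K n} :
    R ∈ Set.range (segre hn) ↔ ∃ (y : Vec K h) (z : Vec K k), segreVec n y z = R.rep := by
  constructor
  · rintro ⟨⟨P, Q⟩, rfl⟩
    obtain ⟨c, -, hc⟩ := exists_rep_segre_eq_smul hn P Q
    exact ⟨c • P.rep, (1 : K) • Q.rep, by rw [hc, segreVec_smul_smul, mul_one]⟩
  · rintro ⟨y, z, hyz⟩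
    have hR : segreLinear K n h k y z ≠ 0 := hyz.trans_ne R.rep_nonzero
    have hy : y ≠ 0 := fun hy => hR (by rw [hy, map_zero, LinearMap.zero_apply])
    have hz : z ≠ 0 := fun hz => hR (by rw [hz, map_zero])
    exact ⟨(Projectivization.mk K y hy, Projectivization.mk K z hz), by
      simp only [segre_mk, hyz, Projectivization.mk_rep]⟩

theorem isClosed_range_segre (hn : (h + 1) * (k + 1) ≤ n + 1) :
    IsClosed (Set.range (segre (K := K) hn)) := by
  let X : Fin (n + 1) → MvPolynomial (Fin (n + 1)) K := MvPolynomial.X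
  have hX : ∀ t, (X t).IsHomogeneous 1 := MvPolynomial.isHomogeneous_X K
  have hrange : Set.range (segre hn) =
      (⋂ t ∉ Set.range (segreIndex hn), {R | MvPolynomial.eval R.rep (X t) = 0}) ∩
      ⋂ i, ⋂ i', ⋂ j, ⋂ j', {R | MvPolynomial.eval R.rep
        (X (segreIndex hn (i, j)) * X (segreIndex hn (i', j')) -
          X (segreIndex hn (i, j')) * X (segreIndex hn (i', j))) = 0} := by
    ext R
    simp only [X, mem_range_segre_iff, exists_segreVec_eq_iff hn, Set.mem_inter_iff, Set.mem_iInter,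
      Set.mem_ofPred_eq, map_sub, map_mul, MvPolynomial.eval_X, sub_eq_zero]
  rw [hrange]
  refine .inter (isClosed_biInter fun t _ => isClosed_setOf_eval_rep_eq_zero (hX t)) ?_
  exact isClosed_iInter fun i => isClosed_iInter fun i' => isClosed_iInter fun j =>
    isClosed_iInter fun j' => isClosed_setOf_eval_rep_eq_zero
      (((hX _).mul (hX _)).sub ((hX _).mul (hX _)))

theorem forall_funLeft_segreIndex_left_mem_affineCone_iff (hn : (h + 1) * (k + 1) ≤ n + 1)
    {X : Set (PSpace K h)} {P : PSpace K h} {Q : PSpace K k} :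
    (∀ j, LinearMap.funLeft K K (fun i => segreIndex hn (i, j)) (segre hn (P, Q)).rep ∈
      affineCone X) ↔ P ∈ X := by
  obtain ⟨c, hc, hcPQ⟩ := exists_rep_segre_eq_smul hn P Q
  have hcolumn : ∀ j, LinearMap.funLeft K K (fun i => segreIndex hn (i, j))
      (segre hn (P, Q)).rep = (c • Q.rep) j • P.rep := by
    intro j
    ext i
    simp only [hcPQ, LinearMap.funLeft_apply, Pi.smul_apply, smul_eq_mul, segreVec_segreIndex]
    ring
  simp only [hcolumn, forall_smul_mem_affineCone_iff (smul_ne_zero hc Q.rep_nonzero),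
    rep_mem_affineCone_iff]

theorem forall_funLeft_segreIndex_right_mem_affineCone_iff (hn : (h + 1) * (k + 1) ≤ n + 1)
    {Y : Set (PSpace K k)} {P : PSpace K h} {Q : PSpace K k} :
    (∀ i, LinearMap.funLeft K K (fun j => segreIndex hn (i, j)) (segre hn (P, Q)).rep ∈
      affineCone Y) ↔ Q ∈ Y := by
  obtain ⟨c, hc, hcPQ⟩ := exists_rep_segre_eq_smul hn P Q
  have hrow : ∀ i, LinearMap.funLeft K K (fun j => segreIndex hn (i, j))
      (segre hn (P, Q)).rep = (c • P.rep) i • Q.rep := by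
    intro i
    ext j
    simp only [hcPQ, LinearMap.funLeft_apply, Pi.smul_apply, smul_eq_mul, segreVec_segreIndex]
    ring
  simp only [hrow, forall_smul_mem_affineCone_iff (smul_ne_zero hc P.rep_nonzero),
    rep_mem_affineCone_iff]

theorem isClosed_segre_image_prod (hn : (h + 1) * (k + 1) ≤ n + 1) {X : Set (PSpace K h)}
    {Y : Set (PSpace K k)} (hX : IsClosed X) (hY : IsClosed Y) :
    IsClosed (segre hn '' X ×ˢ Y) := by
  have hpreimage : X ×ˢ Y = segre hn ⁻¹'
      ((⋂ j, {R | LinearMap.funLeft K K (fun i => segreIndex hn (i, j)) R.rep ∈ affineCone X}) ∩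
        ⋂ i, {R | LinearMap.funLeft K K (fun j => segreIndex hn (i, j)) R.rep ∈ affineCone Y}) := by
    ext ⟨P, Q⟩
    simp only [Set.mem_preimage, Set.mem_inter_iff, Set.mem_iInter, Set.mem_ofPred_eq, Set.mem_prod,
      forall_funLeft_segreIndex_left_mem_affineCone_iff,
      forall_funLeft_segreIndex_right_mem_affineCone_iff]
  rw [hpreimage, Set.image_preimage_eq_inter_range]
  exact ((isClosed_iInter fun _ => isClosed_setOf_apply_rep_mem_affineCone _ hX).inter
    (isClosed_iInter fun _ => isClosed_setOf_apply_rep_mem_affineCone _ hY)).inter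
      (isClosed_range_segre hn)

theorem IsSubvariety.segre_image_prod (hn : (h + 1) * (k + 1) ≤ n + 1) {X : Set (PSpace K h)}
    {Y : Set (PSpace K k)} (hX : IsSubvariety X) (hY : IsSubvariety Y) :
    IsSubvariety (segre hn '' X ×ˢ Y) :=
  ⟨isClosed_segre_image_prod hn hX.1 hY.1,
    isIrreducible_image_prod hX.2 hY.2 (continuous_segre_left hn) (continuous_segre_right hn)⟩

end Segre

section LinearAlgebra

theorem exists_linearEquiv_apply_eq {K V ι : Type*} [DivisionRing K] [AddCommGroup V] [Module K V]
    [Finite ι] {v w : ι → V} (hv : LinearIndependent K v) (hw : LinearIndependent K w) :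
    ∃ g : V ≃ₗ[K] V, ∀ i, g (v i) = w i := by
  have : FiniteDimensional K (Submodule.span K (Set.range v)) :=
    FiniteDimensional.span_of_finite K (Set.finite_range v)
  obtain ⟨g, hg⟩ := Submodule.exists_linearEquiv_restrict_eq
    ((Module.Basis.span hv).equiv (Module.Basis.span hw) (Equiv.refl ι))
  refine ⟨g, fun i => ?_⟩
  have hgi := hg (Module.Basis.span hv i)
  rw [Module.Basis.equiv_apply, Module.Basis.span_apply, Module.Basis.span_apply] at hgi
  exact hgi.symm

variable {K : Type*} [Field K]

theorem linearIndependent_row_iff_exists_det_submatrix_ne_zero {ι τ : Type*} [Fintype ι]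
    [DecidableEq ι] [Finite τ] (A : Matrix ι τ K) :
    LinearIndependent K A.row ↔ ∃ e : ι → τ, (A.submatrix id e).det ≠ 0 := by
  have := Fintype.ofFinite τ
  constructor
  · intro hA
    obtain ⟨κ, a, ha, hspan, hcols⟩ := exists_linearIndependent' K A.col
    have : Finite κ := Finite.of_injective a ha
    have := Fintype.ofFinite κ
    have hcard : Fintype.card κ = Fintype.card ι := by
      rw [← hA.rank_matrix, Matrix.rank_eq_finrank_span_cols, ← hspan, finrank_span_eq_card hcols]
    let e := Fintype.equivOfCardEq hcard
    refine ⟨a ∘ e.symm, ?_⟩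
    rw [← isUnit_iff_ne_zero, ← Matrix.isUnit_iff_isUnit_det,
      ← Matrix.linearIndependent_cols_iff_isUnit]
    exact hcols.comp e.symm e.symm.injective
  · rintro ⟨e, he⟩
    exact .of_comp (LinearMap.funLeft K K e) (Matrix.linearIndependent_rows_of_det_ne_zero he)

variable {A : Type*} [CommRing A] [Algebra K A]

theorem linearDisjoint_span_iff {ι κ : Type*} {a : ι → A} {b : κ → A}
    (ha : LinearIndependent K a) (hb : LinearIndependent K b) :
    (Submodule.span K (Set.range a)).LinearDisjoint (Submodule.span K (Set.range b)) ↔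
      LinearIndependent K fun p : ι × κ => a p.1 * b p.2 := by
  constructor
  · intro H
    simpa only [Module.Basis.span_apply] using H.linearIndependent_mul_of_flat_left
      (Module.Basis.span ha).linearIndependent (Module.Basis.span hb).linearIndependent
  · intro H
    exact .of_basis_mul _ _ (Module.Basis.span ha) (Module.Basis.span hb)
      (by simpa only [Module.Basis.span_apply] using H)

theorem mul_ne_zero_of_linearDisjoint {M N : Submodule K A} (H : M.LinearDisjoint N) {x y : A}
    (hx : x ∈ M) (hy : y ∈ N) (hx0 : x ≠ 0) (hy0 : y ≠ 0) : x * y ≠ 0 :=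
  (H.linearIndependent_mul_of_flat_left
    (m := fun _ : Unit => ⟨x, hx⟩) (n := fun _ : Unit => ⟨y, hy⟩)
    (linearIndependent_unique_iff.mpr (by simpa using hx0))
    (linearIndependent_unique_iff.mpr (by simpa using hy0))).ne_zero ((), ())

end LinearAlgebra

section Grassmannian

variable {K : Type*} [Field K] {m n h k d : ℕ}

theorem isOpenInGrassProd_linearDisjoint :
    IsOpenInGrassProd {L : Grass K n h × Grass K n k | L.1.1.LinearDisjoint L.2.1} := by
  let products : Matrix (Fin (h + 1) × Fin (k + 1)) (Fin (n + 1))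
      (MvPolynomial ((Fin (h + 1) × Fin (n + 1)) ⊕ (Fin (k + 1) × Fin (n + 1))) K) :=
    .of fun p t => .X (.inl (p.1, t)) * .X (.inr (p.2, t))
  refine ⟨Set.range fun e => (products.submatrix id e).det, fun a b ha hb => ?_⟩
  have hproducts : ∀ e, MvPolynomial.eval (Sum.elim (fun s => a s.1 s.2) fun s => b s.1 s.2)
      (products.submatrix id e).det =
        ((Matrix.of fun p : Fin (h + 1) × Fin (k + 1) => a p.1 * b p.2).submatrix id e).det := by
    intro e
    rw [RingHom.map_det]
    congr 1
    ext p q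
    simp [products]
  simp only [Set.exists_range_iff, hproducts]
  exact (linearDisjoint_span_iff ha hb).trans
    (linearIndependent_row_iff_exists_det_submatrix_ne_zero _)

theorem exists_linearDisjoint_grass (hn : (h + 1) * (k + 1) ≤ n + 1) :
    {L : Grass K n h × Grass K n k | L.1.1.LinearDisjoint L.2.1}.Nonempty := by
  let a : Fin (h + 1) → Vec K n := fun i => segreVec n (Pi.single i 1 : Vec K h) (1 : Vec K k)
  let b : Fin (k + 1) → Vec K n := fun j => segreVec n (1 : Vec K h) (Pi.single j 1 : Vec K k)
  have hab : LinearIndependent K fun p : Fin (h + 1) × Fin (k + 1) => a p.1 * b p.2 := by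
    simp only [a, b, segreVec_mul_segreVec, mul_one, one_mul, segreVec_single hn]
    exact (Pi.linearIndependent_single_one (Fin (n + 1)) K).comp _ (segreIndex hn).injective
  have ha : LinearIndependent K a := .of_comp (LinearMap.mulRight K (b 0))
    (hab.comp (fun i => (i, 0)) (Prod.mk_left_injective 0))
  have hb : LinearIndependent K b := .of_comp (LinearMap.mulLeft K (a 0))
    (hab.comp (fun j => (0, j)) (Prod.mk_right_injective 0))
  exact ⟨(Grass.ofFrame a ha, Grass.ofFrame b hb), (linearDisjoint_span_iff ha hb).mpr hab⟩

theorem Grass.mem_points_iff {L : Grass K n d} {P : PSpace K n} : P ∈ L.points ↔ P.rep ∈ L.1 := by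
  rw [Grass.points, Set.mem_ofPred_eq, P.submodule_eq, Submodule.span_singleton_le_iff_mem]

theorem Grass.points_eq_range_map (L : Grass K n d) (f : Vec K m →ₗ[K] Vec K n)
    (hf : Function.Injective f) (hfL : LinearMap.range f = L.1) :
    L.points = Set.range (Projectivization.map f hf) := by
  ext P
  rw [mem_points_iff, mem_range_map_iff, hfL]

theorem Grass.exists_parametrization (L : Grass K n d) :
    ∃ f : Vec K d →ₗ[K] Vec K n, Function.Injective f ∧ LinearMap.range f = L.1 := by
  have e : Vec K d ≃ₗ[K] L.1 := LinearEquiv.ofFinrankEq _ _ (by rw [L.2]; simp)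
  exact ⟨L.1.subtype ∘ₗ e, L.1.injective_subtype.comp e.injective, by
    rw [LinearMap.range_comp, LinearEquiv.range, Submodule.map_top, Submodule.range_subtype]⟩

end Grassmannian

section HadamardProduct

variable {K : Type*} [Field K] {n h k : ℕ}

theorem hadamardDefined_of_linearDisjoint {L : Grass K n h} {M : Grass K n k}
    (H : L.1.LinearDisjoint M.1) {P Q : PSpace K n} (hP : P ∈ L.points) (hQ : Q ∈ M.points) :
    HadamardDefined P Q :=
  mul_ne_zero_of_linearDisjoint H (Grass.mem_points_iff.mp hP) (Grass.mem_points_iff.mp hQ)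
    P.rep_nonzero Q.rep_nonzero

theorem exists_linearEquiv_segreVec_eq_mul (hn : (h + 1) * (k + 1) ≤ n + 1)
    {f : Vec K h →ₗ[K] Vec K n} {g : Vec K k →ₗ[K] Vec K n}
    (hf : Function.Injective f) (hg : Function.Injective g)
    (hfg : (LinearMap.range f).LinearDisjoint (LinearMap.range g)) :
    ∃ T : Vec K n ≃ₗ[K] Vec K n, ∀ y z, T (segreVec n y z) = f y * g z := by
  have hproducts : LinearIndependent K fun p : Fin (h + 1) × Fin (k + 1) =>
      f (Pi.single p.1 1) * g (Pi.single p.2 1) :=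
    hfg.linearIndependent_mul_of_flat_left
      (m := fun i => f.rangeRestrict (Pi.single i 1))
      (n := fun j => g.rangeRestrict (Pi.single j 1))
      (.of_comp (Submodule.subtype _)
        ((Pi.linearIndependent_single_one _ K).map' f (LinearMap.ker_eq_bot.mpr hf)))
      (.of_comp (Submodule.subtype _)
        ((Pi.linearIndependent_single_one _ K).map' g (LinearMap.ker_eq_bot.mpr hg)))
  obtain ⟨T, hT⟩ := exists_linearEquiv_apply_eq
    ((Pi.linearIndependent_single_one (Fin (n + 1)) K).comp _ (segreIndex hn).injective) hproducts
  have hbilinear : (segreLinear K n h k).compr₂ (T : Vec K n →ₗ[K] Vec K n) =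
      (LinearMap.mul K (Vec K n)).compl₁₂ f g := by
    refine LinearMap.pi_ext' fun i => LinearMap.ext_ring (LinearMap.pi_ext' fun j =>
      LinearMap.ext_ring ?_)
    simpa [segreLinear_apply, segreVec_single hn (i, j)] using hT (i, j)
  exact ⟨T, LinearMap.congr_fun₂ hbilinear⟩

theorem map_segre_eq_hadamardPoint (hn : (h + 1) * (k + 1) ≤ n + 1)
    {f : Vec K h →ₗ[K] Vec K n} {g : Vec K k →ₗ[K] Vec K n}
    (hf : Function.Injective f) (hg : Function.Injective g) {T : Vec K n ≃ₗ[K] Vec K n}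
    (hT : ∀ y z, T (segreVec n y z) = f y * g z) (P : PSpace K h) (Q : PSpace K k)
    (H : HadamardDefined (Projectivization.map f hf P) (Projectivization.map g hg Q)) :
    Projectivization.map (T : Vec K n →ₗ[K] Vec K n) T.injective (segre hn (P, Q)) =
      hadamardPoint (Projectivization.map f hf P) (Projectivization.map g hg Q) H := by
  obtain ⟨a, -, haP⟩ := exists_rep_map_eq_smul f hf P
  obtain ⟨b, -, hbQ⟩ := exists_rep_map_eq_smul g hg Q
  refine ((Projectivization.mk_eq_mk_iff' K _ _ _ _).mpr ⟨a * b, ?_⟩).symm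
  rw [haP, hbQ, smul_mul_smul_comm, ← hT]
  rfl

theorem exists_linearEquiv_map_segre_image_eq_hadamardPoints (hn : (h + 1) * (k + 1) ≤ n + 1)
    {L : Grass K n h} {M : Grass K n k} (H : L.1.LinearDisjoint M.1) {X Y : Set (PSpace K n)}
    (hXL : X ⊆ L.points) (hYM : Y ⊆ M.points) {f : Vec K h →ₗ[K] Vec K n}
    {g : Vec K k →ₗ[K] Vec K n} (hf : Function.Injective f) (hg : Function.Injective g)
    (hfL : LinearMap.range f = L.1) (hgM : LinearMap.range g = M.1) :
    ∃ T : Vec K n ≃ₗ[K] Vec K n, Projectivization.map (T : Vec K n →ₗ[K] Vec K n) T.injective ''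
      (segre hn '' ((Projectivization.map f hf ⁻¹' X) ×ˢ (Projectivization.map g hg ⁻¹' Y))) =
        hadamardPoints X Y := by
  obtain ⟨T, hT⟩ := exists_linearEquiv_segreVec_eq_mul hn hf hg (by rwa [hfL, hgM])
  refine ⟨T, ?_⟩
  ext R
  constructor
  · rintro ⟨_, ⟨⟨P, Q⟩, ⟨hP, hQ⟩, rfl⟩, rfl⟩
    exact ⟨_, hP, _, hQ, hadamardDefined_of_linearDisjoint H (hXL hP) (hYM hQ),
      map_segre_eq_hadamardPoint hn hf hg hT P Q _⟩
  · rintro ⟨P', hP, Q', hQ, hPQ, rfl⟩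
    obtain ⟨P, rfl⟩ := L.points_eq_range_map f hf hfL ▸ hXL hP
    obtain ⟨Q, rfl⟩ := M.points_eq_range_map g hg hgM ▸ hYM hQ
    exact ⟨_, ⟨(P, Q), ⟨hP, hQ⟩, rfl⟩, map_segre_eq_hadamardPoint hn hf hg hT P Q hPQ⟩

theorem projectivelyEquivalent_segre_hadamardPoints (hn : (h + 1) * (k + 1) ≤ n + 1)
    {L : Grass K n h} {M : Grass K n k} (H : L.1.LinearDisjoint M.1) {X Y : Set (PSpace K n)}
    (hX : IsSubvariety X) (hY : IsSubvariety Y) (hXL : X ⊆ L.points) (hYM : Y ⊆ M.points)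
    {f : Vec K h →ₗ[K] Vec K n} {g : Vec K k →ₗ[K] Vec K n} (hf : Function.Injective f)
    (hg : Function.Injective g) (hfL : LinearMap.range f = L.1) (hgM : LinearMap.range g = M.1) :
    ProjectivelyEquivalent
      (segre hn '' ((Projectivization.map f hf ⁻¹' X) ×ˢ (Projectivization.map g hg ⁻¹' Y)))
      (hadamardPoints X Y) := by
  obtain ⟨T, hT⟩ :=
    exists_linearEquiv_map_segre_image_eq_hadamardPoints hn H hXL hYM hf hg hfL hgM
  have hsegre := IsSubvariety.segre_image_prod hn
    (hX.preimage_map f hf (hXL.trans_eq (L.points_eq_range_map f hf hfL)))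
    (hY.preimage_map g hg (hYM.trans_eq (M.points_eq_range_map g hg hgM)))
  exact ⟨hsegre, hT ▸ hsegre.image_map _ T.injective, T, hT⟩

theorem hadamardProduct_eq_hadamardPoints (hn : (h + 1) * (k + 1) ≤ n + 1) {L : Grass K n h}
    {M : Grass K n k} (H : L.1.LinearDisjoint M.1) {X Y : Set (PSpace K n)} (hX : IsSubvariety X)
    (hY : IsSubvariety Y) (hXL : X ⊆ L.points) (hYM : Y ⊆ M.points) :
    hadamardProduct X Y = hadamardPoints X Y := by
  obtain ⟨f, hf, hfL⟩ := L.exists_parametrization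
  obtain ⟨g, hg, hgM⟩ := M.exists_parametrization
  obtain ⟨-, hXY, -⟩ :=
    projectivelyEquivalent_segre_hadamardPoints hn H hX hY hXL hYM hf hg hfL hgM
  exact hXY.1.closure_eq

end HadamardProduct

theorem mainTheorem1_general {K : Type*} [Field K] (n h k : ℕ)
    (hn : (h + 1) * (k + 1) ≤ n + 1) :
    ForGenericPair fun (Lh : Grass K n h) (Lk : Grass K n k) =>
      ∀ X Y : Set (PSpace K n), IsSubvariety X → IsSubvariety Y →
        X ⊆ Lh.points → Y ⊆ Lk.points →
        (∀ (f : Vec K h →ₗ[K] Vec K n) (g : Vec K k →ₗ[K] Vec K n)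
          (hf : Function.Injective f) (hg : Function.Injective g),
          LinearMap.range f = Lh.1 → LinearMap.range g = Lk.1 →
          ProjectivelyEquivalent
            (segre hn '' ((Projectivization.map f hf ⁻¹' X) ×ˢ (Projectivization.map g hg ⁻¹' Y)))
            (hadamardProduct X Y)) ∧
        (∀ P ∈ X, ∀ Q ∈ Y, HadamardDefined P Q) ∧
        hadamardProduct X Y = hadamardPoints X Y := by
  refine ⟨{L | L.1.1.LinearDisjoint L.2.1}, isOpenInGrassProd_linearDisjoint,
    exists_linearDisjoint_grass hn, ?_⟩
  rintro ⟨Lh, Lk⟩ hL X Y hX hY hXL hYL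
  have hclosed := hadamardProduct_eq_hadamardPoints hn hL hX hY hXL hYL
  refine ⟨fun f g hf hg hfL hgL => ?_, fun P hP Q hQ => ?_, hclosed⟩
  · rw [hclosed]
    exact projectivelyEquivalent_segre_hadamardPoints hn hL hX hY hXL hYL hf hg hfL hgL
  · exact hadamardDefined_of_linearDisjoint hL (hXL hP) (hYL hQ)

theorem mainTheorem1 {K : Type*} [Field K] [IsAlgClosed K] [CharZero K] (n h k : ℕ)
    (hn : (h + 1) * (k + 1) ≤ n + 1) :
    ForGenericPair fun (Lh : Grass K n h) (Lk : Grass K n k) =>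
      ∀ X Y : Set (PSpace K n), IsSubvariety X → IsSubvariety Y →
        X ⊆ Lh.points → Y ⊆ Lk.points →
        -- for all parameterizations `f` of `Lh` and `g` of `Lk`
        (∀ (f : Vec K h →ₗ[K] Vec K n) (g : Vec K k →ₗ[K] Vec K n)
          (hf : Function.Injective f) (hg : Function.Injective g),
          LinearMap.range f = Lh.1 → LinearMap.range g = Lk.1 →
          ProjectivelyEquivalent
            (segre hn '' ((Projectivization.map f hf ⁻¹' X) ×ˢ (Projectivization.map g hg ⁻¹' Y)))
            (hadamardProduct X Y)) ∧
        (∀ P ∈ X, ∀ Q ∈ Y, HadamardDefined P Q) ∧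
        hadamardProduct X Y = hadamardPoints X Y :=
  mainTheorem1_general n h k hn
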